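/- Let $\mathbb{L} = \mathbb{R}((x))$ be the field of formal Laurent series in one variable over $\mathbb{R}$, linearly ordered by declaring a nonzero series $\sum_{i \ge n} a_i x^i$ with $a_n \neq 0$ to be positive if and only if $a_n > 0$, and equipped with the field-metric $d : \mathbb{L} \times \mathbb{L} \to \mathbb{L}$, $d(y,z) = |y - z|$ (where $|w| = \max(w,-w)$). Call $r, s \in \mathbb{L}$ infinitesimally close if $|r - s| < 1/n$ for every positive integer $n$, and regard $\mathbb{R} \subseteq \mathbb{L}$ as the constant series. Let $f : \mathbb{L} \to \mathbb{L}$ be a function for which there exist a real number $a \in [0,1)$ and an element $r \in \mathbb{L}$ infinitesimally close to $a$ such that \[ d(f(y), f(z)) \le r \cdot d(y,z) \quad \text{for all } y, z \in \mathbb{L}. \] Then $f$ has a unique fixed point, i.e. there is exactly one $y \in \mathbb{L}$ with $f(y) = y$. -/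

import Mathlib

/-- A field-metric on `X` with values in the linearly ordered field `F`. -/
structure FieldMetric (X F : Type*) [Field F] [LinearOrder F] [IsStrictOrderedRing F] where
  d : X → X → F
  symm : ∀ x y, d x y = d y x
  triangle : ∀ x y z, d x z ≤ d x y + d y z
  eq_zero_iff : ∀ x y, d x y = 0 ↔ x = y

/-- The field-metric `d(x, y) = |x - y|` of a linearly ordered field on itself. -/
def FieldMetric.self (F : Type*) [Field F] [LinearOrder F] [IsStrictOrderedRing F] :
    FieldMetric F F where
  d x y := |x - y|
  symm := abs_sub_comm
  triangle := abs_sub_le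
  eq_zero_iff x y := by rw [abs_eq_zero, sub_eq_zero]

/-- Two elements of a linearly ordered field are infinitesimally close if `|x - y| < 1 / n`
for every positive integer `n`. -/
def InfinitesimallyClose {F : Type*} [Field F] [LinearOrder F] [IsStrictOrderedRing F]
    (x y : F) : Prop :=
  ∀ n : ℕ, 0 < n → |x - y| < 1 / (n : F)

/-- The formal Laurent series over `ℝ`. The synonym `Lex` provides the linear order in which a
nonzero series is positive iff its coefficient of lowest degree is positive
(`HahnSeries.leadingCoeff_pos_iff`). -/
abbrev OrderedLaurent : Type := Lex (LaurentSeries ℝ)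

/-- The inclusion of `ℝ` into the Laurent series as the constant series. -/
noncomputable def OrderedLaurent.const (a : ℝ) : OrderedLaurent :=
  toLex (HahnSeries.C a : LaurentSeries ℝ)

/-- The field-metric `d(y, z) = |y - z|` on the field of formal Laurent series over `ℝ`. -/
noncomputable def OrderedLaurent.fieldMetric : FieldMetric OrderedLaurent OrderedLaurent :=
  FieldMetric.self OrderedLaurent

/-! Iterating `f` need not converge: powers of a positive real ratio do not tend to 0 in the order
topology. The fixed point is built one coefficient at a time. Replace `r` by a real `b < 1`. The
order is lexicographic, so `f` respects agreement below degree `m`, and among series agreeing there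
it contracts the degree-`m` coefficient by `b` (`abs_coeff_map_sub_map_le`). Banach on `ℝ` then
corrects that coefficient (`exists_improved_fixedPoint`), and the corrections add up to a series
(`exists_limit`). -/

namespace OrderedLaurent

/-- The additive subgroup of the series whose coefficients of degree less than `m` vanish. -/
def vanishBelow (m : ℤ) : AddSubgroup OrderedLaurent where
  carrier := {w | ∀ i < m, (ofLex w).coeff i = 0}
  zero_mem' := fun i _ => by simp
  add_mem' := fun {u v} hu hv i hi => by simp [hu i hi, hv i hi]
  neg_mem' := fun {u} hu i hi => by simp [hu i hi]

theorem mem_vanishBelow {m : ℤ} {w : OrderedLaurent} :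
    w ∈ vanishBelow m ↔ ∀ i < m, (ofLex w).coeff i = 0 :=
  Iff.rfl

theorem sub_mem_vanishBelow {m : ℤ} {u v : OrderedLaurent} :
    u - v ∈ vanishBelow m ↔ ∀ i < m, (ofLex u).coeff i = (ofLex v).coeff i := by
  simp [mem_vanishBelow, sub_eq_zero]

theorem vanishBelow_anti {m n : ℤ} (h : m ≤ n) : vanishBelow n ≤ vanishBelow m :=
  fun _ hw i hi => hw i (hi.trans_le h)

theorem mem_vanishBelow_succ {m : ℤ} {w : OrderedLaurent} (hw : w ∈ vanishBelow m)
    (h : (ofLex w).coeff m = 0) : w ∈ vanishBelow (m + 1) := by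
  intro i hi
  rcases (Int.lt_add_one_iff.mp hi).lt_or_eq with h' | rfl
  · exact hw i h'
  · exact h

theorem eq_zero_of_forall_mem_vanishBelow {m : ℤ} {w : OrderedLaurent}
    (h : ∀ k : ℕ, w ∈ vanishBelow (m + k)) : w = 0 := by
  apply ofLex.injective
  ext i
  exact h ((i - m).toNat + 1) i (by omega)

theorem coeff_le_coeff {m : ℤ} {u v : OrderedLaurent} (huv : u ≤ v)
    (h : ∀ i < m, (ofLex u).coeff i = (ofLex v).coeff i) :
    (ofLex u).coeff m ≤ (ofLex v).coeff m := by
  rcases huv.eq_or_lt with rfl | hlt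
  · exact le_rfl
  obtain ⟨i, hj, hi⟩ := (HahnSeries.lt_iff _ _).mp hlt
  rcases lt_trichotomy i m with him | rfl | him
  · exact absurd (h i him) hi.ne
  · exact hi.le
  · exact (hj m him).le

/-- A leading term of `u` in degree below `m` would be positive where `v` still vanishes, forcing `u
> v`. -/
theorem mem_vanishBelow_of_le {m : ℤ} {u v : OrderedLaurent} (hu : 0 ≤ u) (huv : u ≤ v)
    (hv : v ∈ vanishBelow m) : u ∈ vanishBelow m := by
  rcases hu.eq_or_lt with rfl | hlt
  · exact zero_mem _
  obtain ⟨i, hj, hi⟩ := (HahnSeries.lt_iff _ _).mp hlt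
  have hu' : u ∈ vanishBelow i := fun j hji => by simpa using (hj j hji).symm
  by_cases him : i < m
  · have := coeff_le_coeff (m := i) huv fun j hji => by rw [hu' j hji, hv j (hji.trans him)]
    rw [hv i him] at this
    exact absurd (by simpa using hi) this.not_gt
  · exact vanishBelow_anti (not_lt.mp him) hu'

theorem abs_mem_vanishBelow {m : ℤ} {w : OrderedLaurent} :
    |w| ∈ vanishBelow m ↔ w ∈ vanishBelow m := by
  rcases abs_choice w with h | h <;> simp [h]

theorem coeff_abs {m : ℤ} {w : OrderedLaurent} (hw : w ∈ vanishBelow m) :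
    (ofLex |w|).coeff m = |(ofLex w).coeff m| := by
  have h0 : 0 ≤ (ofLex |w|).coeff m := by
    simpa using coeff_le_coeff (m := m) (abs_nonneg w)
      fun i hi => by simpa using (abs_mem_vanishBelow.mpr hw i hi).symm
  rcases abs_choice w with h | h <;> rw [h] at h0 ⊢
  · rw [abs_of_nonneg h0]
  · have h1 : (ofLex w).coeff m ≤ 0 := by simpa using h0
    rw [abs_of_nonpos h1]
    simp

theorem coeff_const_mul (b : ℝ) (w : OrderedLaurent) (i : ℤ) :
    (ofLex (const b * w)).coeff i = b * (ofLex w).coeff i := by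
  simp [const]

theorem const_mul_mem_vanishBelow {m : ℤ} {w : OrderedLaurent} (b : ℝ)
    (hw : w ∈ vanishBelow m) : const b * w ∈ vanishBelow m := fun i hi => by
  rw [coeff_const_mul, hw i hi, mul_zero]

theorem const_lt_const {a b : ℝ} (h : a < b) : const a < const b := by
  refine (HahnSeries.lt_iff _ _).mpr ⟨0, fun j hj => ?_, by simpa [const] using h⟩
  simp [const, HahnSeries.C_apply, HahnSeries.coeff_single_of_ne hj.ne]

theorem one_div_natCast (n : ℕ) : (1 / (n : OrderedLaurent)) = const (1 / n) := by
  change toLex (1 / (n : LaurentSeries ℝ)) = toLex (HahnSeries.C (1 / (n : ℝ)))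
  rw [map_div₀ HahnSeries.C, map_one HahnSeries.C, map_natCast HahnSeries.C]

theorem const_add (a b : ℝ) : const (a + b) = const a + const b := by
  simp [const]

/-- An element infinitesimally close to a real `a < b` is less than `b`. -/
theorem lt_const_of_infinitesimallyClose {r : OrderedLaurent} {a b : ℝ} (hab : a < b)
    (h : InfinitesimallyClose r (const a)) : r < const b := by
  obtain ⟨n, hn⟩ := exists_nat_one_div_lt (sub_pos.mpr hab)
  have h1 := (abs_lt.mp (h (n + 1) n.succ_pos)).2
  rw [one_div_natCast, sub_lt_iff_lt_add, ← const_add] at h1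
  refine h1.trans (const_lt_const ?_)
  push_cast
  linarith

section Contraction

variable {f : OrderedLaurent → OrderedLaurent} {b : NNReal}

theorem map_sub_map_mem_vanishBelow (hf : ∀ y z, |f y - f z| ≤ const b * |y - z|) {m : ℤ}
    {y z : OrderedLaurent} (h : y - z ∈ vanishBelow m) : f y - f z ∈ vanishBelow m :=
  abs_mem_vanishBelow.mp <| mem_vanishBelow_of_le (abs_nonneg _) (hf y z) <|
    const_mul_mem_vanishBelow _ <| abs_mem_vanishBelow.mpr h

theorem abs_coeff_map_sub_map_le (hf : ∀ y z, |f y - f z| ≤ const b * |y - z|) {m : ℤ}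
    {y z : OrderedLaurent} (h : y - z ∈ vanishBelow m) :
    |(ofLex (f y - f z)).coeff m| ≤ b * |(ofLex (y - z)).coeff m| := by
  have h' := map_sub_map_mem_vanishBelow hf h
  rw [← coeff_abs h, ← coeff_abs h', ← coeff_const_mul]
  exact coeff_le_coeff (hf y z) fun i hi => by
    rw [abs_mem_vanishBelow.mpr h' i hi,
      const_mul_mem_vanishBelow _ (abs_mem_vanishBelow.mpr h) i hi]

/-- An approximate fixed point up to degree `m` can be corrected in degree `m`, by the Banach
fixed point theorem on `ℝ`. -/
theorem exists_improved_fixedPoint (hb : b < 1)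
    (hf : ∀ y z, |f y - f z| ≤ const b * |y - z|) {m : ℤ} {z : OrderedLaurent}
    (hz : f z - z ∈ vanishBelow m) :
    ∃ z', z' - z ∈ vanishBelow m ∧ f z' - z' ∈ vanishBelow (m + 1) := by
  let t : ℝ → OrderedLaurent := fun c => z + toLex (HahnSeries.single m c)
  have ht (c : ℝ) : t c - z ∈ vanishBelow m := fun i hi => by
    simp [t, HahnSeries.coeff_single_of_ne hi.ne]
  have htm (c : ℝ) : (ofLex (t c)).coeff m = (ofLex z).coeff m + c := by simp [t]
  let g : ℝ → ℝ := fun c => (ofLex (f (t c))).coeff m - (ofLex z).coeff m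
  have hg : ContractingWith b g := by
    refine ⟨hb, LipschitzWith.of_dist_le_mul fun c c' => ?_⟩
    have := abs_coeff_map_sub_map_le hf (m := m) (y := t c) (z := t c')
      (by simpa using sub_mem (ht c) (ht c'))
    simpa [Real.dist_eq, g, htm] using this
  obtain ⟨c, hc⟩ : ∃ c, g c = c := ⟨_, hg.fixedPoint_isFixedPt⟩
  refine ⟨t c, ht c, mem_vanishBelow_succ ?_ ?_⟩
  -- `f (t c) - t c = (f (t c) - f z) + (f z - z) - (t c - z)`.
  · have := sub_mem (add_mem (map_sub_map_mem_vanishBelow hf (ht c)) hz) (ht c)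
    simpa using this
  · have : (ofLex (f (t c))).coeff m - (ofLex z).coeff m = c := hc
    rw [ofLex_sub, HahnSeries.coeff_sub, htm]
    linarith

/-- A sequence whose consecutive differences vanish to increasing order has a limit. -/
theorem exists_limit {m : ℤ} {s : ℕ → OrderedLaurent}
    (hs : ∀ k : ℕ, s (k + 1) - s k ∈ vanishBelow (m + k)) :
    ∃ z, ∀ k : ℕ, z - s k ∈ vanishBelow (m + k) := by
  have hle {k l : ℕ} (hkl : k ≤ l) : s l - s k ∈ vanishBelow (m + k) := by
    induction l, hkl using Nat.le_induction with
    | base => simp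
    | succ l hkl ih =>
      simpa using add_mem (vanishBelow_anti (by omega) (hs l)) ih
  have heq {k l : ℕ} {i : ℤ} (hk : i < m + k) (hl : i < m + l) :
      (ofLex (s k)).coeff i = (ofLex (s l)).coeff i := by
    rcases le_total k l with h | h
    · exact (sub_mem_vanishBelow.mp (hle h) i hk).symm
    · exact sub_mem_vanishBelow.mp (hle h) i hl
  -- The `+ 1` gives the strict bound `i < m + k`, past which coefficient `i` is stable.
  let c : ℤ → ℝ := fun i => (ofLex (s ((i - m).toNat + 1))).coeff i
  have hc {k : ℕ} {i : ℤ} (hi : i < m + k) : c i = (ofLex (s k)).coeff i :=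
    heq (by omega) hi
  have hbdd : BddBelow (Function.support c) := by
    -- Below `m`, `c` agrees with `s 0`.
    refine ⟨min m (ofLex (s 0)).order, fun i hic => not_lt.mp fun hi => hic ?_⟩
    rw [hc (k := 0) (by simpa using hi.trans_le (min_le_left _ _))]
    exact HahnSeries.coeff_eq_zero_of_lt_order (hi.trans_le (min_le_right _ _))
  exact ⟨toLex (HahnSeries.ofSuppBddBelow c hbdd), fun k =>
    sub_mem_vanishBelow.mpr fun i hi => by simpa using hc hi⟩

theorem exists_fixedPoint (hb : b < 1) (hf : ∀ y z, |f y - f z| ≤ const b * |y - z|) :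
    ∃ z, f z = z := by
  let m : ℤ := (ofLex (f 0)).order
  have h0 : f 0 - 0 ∈ vanishBelow m := fun i hi => by
    simpa using HahnSeries.coeff_eq_zero_of_lt_order hi
  choose! next hnext hnext' using fun (k : ℕ) (z : OrderedLaurent)
    (hz : f z - z ∈ vanishBelow (m + k)) => exists_improved_fixedPoint hb hf hz
  let s : ℕ → OrderedLaurent := fun k => Nat.rec 0 next k
  have hs (k : ℕ) : f (s k) - s k ∈ vanishBelow (m + k) := by
    induction k with
    | zero => simpa [s] using h0
    | succ k ih => simpa [add_assoc] using hnext' k (s k) ih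
  obtain ⟨z, hz⟩ := exists_limit (s := s) fun k => hnext k (s k) (hs k)
  refine ⟨z, sub_eq_zero.mp (eq_zero_of_forall_mem_vanishBelow (m := m) fun k => ?_)⟩
  have := sub_mem (add_mem (map_sub_map_mem_vanishBelow hf (hz k)) (hs k)) (hz k)
  simpa using this

theorem fixedPoint_unique (hb : b < 1) (hf : ∀ y z, |f y - f z| ≤ const b * |y - z|)
    {y z : OrderedLaurent} (hy : f y = y) (hz : f z = z) : y = z := by
  by_contra hne
  have h := hf y z
  rw [hy, hz] at h
  have hb' : const b < 1 := by
    simpa [const] using const_lt_const (NNReal.coe_lt_one.mpr hb)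
  exact (mul_lt_of_lt_one_left (abs_pos.mpr (sub_ne_zero.mpr hne)) hb').not_ge h

end Contraction

end OrderedLaurent

theorem mainTheorem2 (f : OrderedLaurent → OrderedLaurent)
    (hf : ∃ r : OrderedLaurent,
      (∃ a : ℝ, a ∈ Set.Ico (0 : ℝ) 1 ∧ InfinitesimallyClose r (OrderedLaurent.const a)) ∧
      ∀ y z : OrderedLaurent,
        OrderedLaurent.fieldMetric.d (f y) (f z) ≤ r * OrderedLaurent.fieldMetric.d y z) :
    ∃! x : OrderedLaurent, f x = x := by
  obtain ⟨r, ⟨a, ⟨ha0, ha1⟩, hr⟩, hf⟩ := hf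
  -- `r` may exceed `a` infinitesimally; a real `b > a` dominates it and multiplies coefficientwise.
  obtain ⟨b, hab, hb1⟩ := exists_between ha1
  lift b to NNReal using ha0.trans hab.le
  have hf' (y z : OrderedLaurent) : |f y - f z| ≤ OrderedLaurent.const b * |y - z| :=
    (hf y z).trans (mul_le_mul_of_nonneg_right
      (OrderedLaurent.lt_const_of_infinitesimallyClose hab hr).le (abs_nonneg _))
  have hb : b < 1 := by exact_mod_cast hb1
  obtain ⟨z, hz⟩ := OrderedLaurent.exists_fixedPoint hb hf'
  exact ⟨z, hz, fun y hy => OrderedLaurent.fixedPoint_unique hb hf' hy hz⟩
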